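/- Let $k$ be a number field of degree $d=[k:\mathbb{Q}]$ with ring of integers $\mathfrak{o}$, and let $\Sigma$ be the set of the $d$ field embeddings $\sigma:k\hookrightarrow\overline{\mathbb{Q}}$. For a rational prime $p$ put $f_p:=\sum_{\mathfrak{p}\mid p}f_{\mathfrak{p}}$, where $\mathfrak{p}$ runs through the prime ideals of $\mathfrak{o}$ above $p$ and $f_{\mathfrak{p}}$ is the inertia degree of $\mathfrak{p}$ over $p$, and define the tame discriminant $\Delta_{\mathrm{tame}}:=\prod_p p^{\,d-f_p}$, the product being over all rational primes (almost all factors are $1$). Let $\mathfrak{n}\subset\mathfrak{o}$ be a nonzero ideal, let $m$ be an integer with $2\le m\le d$, and let $X\subset\mathfrak{n}$ be a subset with exactly $m$ elements. For an $m$-element subset $S\subset\Sigma$ let ${\det}^2(\sigma(x))_{\sigma\in S,\,x\in X}$ denote the square of the determinant of the $m\times m$ matrix with rows indexed by $S$ and columns indexed by $X$ (it does not depend on the chosen orderings of $S$ and $X$). Then \[\prod_{\substack{S\subset\Sigma\\|S|=m}}{\det}^2(\sigma(x))_{\sigma\in S,\,x\in X}\] is a rational integer, and in $\mathbb{Z}$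 it is divisible by \[\Delta_{\mathrm{tame}}^{\binom{d-2}{m-2}}\,[\mathfrak{o}:\mathfrak{n}]^{2\binom{d-1}{m-1}}.\] -/

import Mathlib

open scoped NumberField

noncomputable section

namespace TameDiv

/-- `f_p`: the sum of the inertia degrees `f_𝔭` over the primes `𝔭` of `𝓞 k` above `p`. -/
def inertiaSum (k : Type*) [Field k] [NumberField k] (p : ℕ) : ℕ :=
  ∑ P ∈ (Algebra.QuasiFinite.finite_primesOver (S := 𝓞 k)
      (Ideal.span {(p : ℤ)})).toFinset, P.inertiaDeg ℤ

/-- The tame discriminant `∏_p p ^ (d - f_p)`, the product over all rational primes `p`, where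
`d = [k : ℚ]`. The helper facts below show that almost all factors are `1` and that `f_p ≤ d`. -/
def tameDiscr (k : Type*) [Field k] [NumberField k] : ℕ :=
  ∏ᶠ p : Nat.Primes, (p : ℕ) ^ (Module.finrank ℚ k - inertiaSum k p)

open Classical in
/-- `det² (A s x)_{s ∈ S, x ∈ X}` for finite sets `S`, `X` of the same size; the rows are matched
with the columns by a bijection, the choice of which does not matter (`detSq_eq`). -/
def detSq {α β R : Type*} [CommRing R] (A : α → β → R) (S : Finset α) (X : Finset β)
    (h : S.card = X.card) : R :=
  (Matrix.of fun s t : S => A s (Finset.equivOfCardEq h t)).det ^ 2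

/-- Any enumerations of `S` and of `X` by the same index type compute `detSq`. -/
theorem detSq_eq {α β R ι : Type*} [CommRing R] [Fintype ι] [DecidableEq ι] (A : α → β → R)
    (S : Finset α) (X : Finset β) (h : S.card = X.card) (a : ι ≃ S) (b : ι ≃ X) :
    detSq A S X h = (Matrix.of fun i j : ι => A (a i) (b j)).det ^ 2 := by
  classical
  let e := Finset.equivOfCardEq h
  let M : Matrix ι ι R := Matrix.of fun i j : ι => A (a i) (e (a j))
  have h1 : detSq A S X h = M.det ^ 2 := by
    unfold detSq
    rw [← Matrix.det_submatrix_equiv_self a]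
    rfl
  let τ : Equiv.Perm ι := (b.trans e.symm).trans a.symm
  have h2 : (Matrix.of fun i j : ι => A (a i) (b j)) = M.submatrix id τ := by
    ext i j
    simp [M, τ]
  rw [h1, h2, Matrix.det_permute', mul_pow, ← Int.cast_pow, ← Units.val_pow_eq_pow_val,
    Int.units_sq]
  simp

theorem sum_ramificationIdx_mul_inertiaDeg (k : Type*) [Field k] [NumberField k]
    (p : Nat.Primes) :
    ∑ P ∈ (Algebra.QuasiFinite.finite_primesOver (S := 𝓞 k)
      (Ideal.span {((p : ℕ) : ℤ)})).toFinset, P.ramificationIdx ℤ * P.inertiaDeg ℤ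
      = Module.finrank ℚ k := by
  have hp : Prime ((p : ℕ) : ℤ) := Nat.prime_iff_prime_int.mp p.2
  have : (Ideal.span {((p : ℕ) : ℤ)}).IsPrime :=
    (Ideal.span_singleton_prime hp.ne_zero).mpr hp
  let _ : Fintype ((Ideal.span {((p : ℕ) : ℤ)}).primesOver (𝓞 k)) :=
    (Algebra.QuasiFinite.finite_primesOver (S := 𝓞 k) (Ideal.span {((p : ℕ) : ℤ)})).fintype
  have hsum := Ideal.sum_ramification_inertia_eq_finrank (Ideal.span {((p : ℕ) : ℤ)}) (𝓞 k)
  refine Eq.trans ?_ (hsum.trans (NumberField.RingOfIntegers.rank k))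
  exact Finset.sum_subtype _ (fun x => by simp) _

theorem inertiaSum_le (k : Type*) [Field k] [NumberField k] (p : Nat.Primes) :
    inertiaSum k p ≤ Module.finrank ℚ k := by
  rw [← sum_ramificationIdx_mul_inertiaDeg k p]
  refine Finset.sum_le_sum fun P hP => ?_
  have hP' : P.IsPrime := by
    simp only [Set.Finite.mem_toFinset] at hP
    exact hP.1
  exact Nat.le_mul_of_pos_left _ (Ideal.ramificationIdx_pos P ℤ)

theorem finite_mulSupport (k : Type*) [Field k] [NumberField k] :
    (Function.mulSupport fun p : Nat.Primes =>
      (p : ℕ) ^ (Module.finrank ℚ k - inertiaSum k p)).Finite := by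
  have hfin : {p : Nat.Primes | (p : ℕ) ∣ (NumberField.discr k).natAbs}.Finite := by
    refine Set.Finite.of_finite_image (f := fun p : Nat.Primes => (p : ℕ)) ?_
      (fun a _ b _ hab => Subtype.ext hab)
    refine (Nat.divisors (NumberField.discr k).natAbs).finite_toSet.subset ?_
    rintro _ ⟨p, hp, rfl⟩
    simpa [NumberField.discr_ne_zero] using hp
  refine hfin.subset fun p hp => ?_
  by_contra hdvd
  apply hp
  have hp1 : Prime ((p : ℕ) : ℤ) := Nat.prime_iff_prime_int.mp p.2
  have hnd : ¬ ((p : ℕ) : ℤ) ∣ NumberField.discr k := by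
    simpa [Int.natCast_dvd] using hdvd
  have hun := (NumberField.not_dvd_discr_iff_isUnramifiedIn k (𝓞 k) hp1).mp hnd
  have : inertiaSum k p = Module.finrank ℚ k := by
    rw [← sum_ramificationIdx_mul_inertiaDeg k p]
    refine Finset.sum_congr rfl fun P hP => ?_
    simp only [Set.Finite.mem_toFinset] at hP
    have := hP.1
    rw [hun.ramificationIdx_eq_one hP.2, one_mul]
  simp [this]

end TameDiv

end

noncomputable section

namespace TameDiv

/-! Divisibility is checked at each prime `Q` of the ring of integers of a field `L` containing all
conjugates of `k`. Let `Q` lie over `p`, and sort the embeddings `σ` by their residue maps `𝓞 k → 𝓞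
L ⧸ Q`. Elements of `𝔫` are expanded in powers of a uniformizer at `P = σ⁻¹ Q`, with digits that are
high powers of the residue cardinality. Modulo a high power of `Q`, the conjugate of such a digit
depends only on the residue map. So rows of one class are combinations of common vectors, the `j`-th
coefficient having order at least `e (n + j)`, where `e` is the ramification index of `Q` over `P`
and `n = ord P 𝔫`. In the multilinear expansion of a minor, two rows of one class using the same
vector cancel, so a class of `t` rows gains `e (0 + 1 + ⋯ + (t - 1))` beyond `t e n`
(`sq_det_mem_pow_ord`).

Summing over all `S` counts single embeddings and pairs, whence the two binomial coefficients. The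
singles give the norm of `𝔫` (`sum_ord_map_eq`). The pairs give at least `(d - f_p) ord_Q p` by
Cauchy–Schwarz, since at most `f_P` classes lie over `P` (`tame_le_sum_classmates`). Galois
invariance and integrality make the product a rational integer. -/

/-! ### Determinants whose rows expand in shared vectors. -/

lemma card_mul_card_pred_le_two_mul_sum (s : Finset ℕ) :
    s.card * (s.card - 1) ≤ 2 * ∑ i ∈ s, i := by
  induction s using Finset.induction_on_max with
  | empty => simp
  | insert a s ha ih =>
    have hna : a ∉ s := fun h => lt_irrefl _ (ha a h)
    -- All of `s` lies below the new maximum `a`; the extremal set is `{0, …, t - 1}`.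
    have hc : s.card ≤ a := by
      simpa using Finset.card_le_card (fun x hx => Finset.mem_range.2 (ha x hx) :
        s ⊆ Finset.range a)
    rw [Finset.card_insert_of_notMem hna, Finset.sum_insert hna, Nat.add_sub_cancel]
    rcases Nat.eq_zero_or_pos s.card with h | h
    · simp [h]
    · obtain ⟨t, ht⟩ := Nat.exists_eq_succ_of_ne_zero h.ne'
      simp only [ht, Nat.succ_eq_add_one, Nat.add_sub_cancel] at *
      nlinarith

open Classical in
/-- The number of indices in `s` other than `i` that lie in the same class as `i`. -/
def classmates {ι γ : Type*} (c : ι → γ) (s : Finset ι) (i : ι) : ℕ :=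
  (s.filter fun i' => i' ≠ i ∧ c i' = c i).card

-- A class of `t` members contributes `e t (t - 1)` on the left. As `r` is injective on it, its
-- values there sum to at least `0 + ⋯ + (t - 1)`.
open Classical in
lemma sum_mul_classmates_le {ι γ : Type*} (c : ι → γ) (e : γ → ℕ) (s : Finset ι) (r : ι → ℕ)
    (hr : ∀ i ∈ s, ∀ i' ∈ s, c i = c i' → r i = r i' → i = i') :
    ∑ i ∈ s, e (c i) * classmates c s i ≤ 2 * ∑ i ∈ s, e (c i) * r i := by
  have hmap : ∀ i ∈ s, c i ∈ s.image c := fun i hi => Finset.mem_image_of_mem c hi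
  rw [← Finset.sum_fiberwise_of_maps_to hmap, ← Finset.sum_fiberwise_of_maps_to hmap,
    Finset.mul_sum]
  refine Finset.sum_le_sum fun g _ => ?_
  have h1 : ∑ i ∈ s.filter (fun i => c i = g), e (c i) * classmates c s i
      = e g * ((s.filter fun i => c i = g).card * ((s.filter fun i => c i = g).card - 1)) := by
    rw [Finset.sum_congr rfl (g := fun _ => e g * ((s.filter fun i => c i = g).card - 1))]
    · rw [Finset.sum_const, smul_eq_mul]; ring
    · intro i hi
      have hi' := (Finset.mem_filter.1 hi)
      rw [hi'.2, classmates, ← Finset.card_erase_of_mem hi, hi'.2]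
      congr 2
      ext x
      simp only [Finset.mem_filter, Finset.mem_erase]
      tauto
  have h2 : ∑ i ∈ s.filter (fun i => c i = g), e (c i) * r i
      = e g * ∑ i ∈ s.filter (fun i => c i = g), r i := by
    rw [Finset.mul_sum]
    exact Finset.sum_congr rfl fun i hi => by rw [(Finset.mem_filter.1 hi).2]
  rw [h1, h2, mul_left_comm 2]
  refine Nat.mul_le_mul_left _ ?_
  have hinj : Set.InjOn r (s.filter fun i => c i = g) := by
    intro i hi i' hi' h
    simp only [Finset.coe_filter, Set.mem_ofPred_eq] at hi hi'
    exact hr i hi.1 i' hi'.1 (hi.2.trans hi'.2.symm) h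
  have := card_mul_card_pred_le_two_mul_sum ((s.filter fun i => c i = g).image r)
  rwa [Finset.card_image_of_injOn hinj, Finset.sum_image hinj] at this

/-- Rows that expand in terms of vectors depending only on the class of the row, with
coefficients of growing order, have a determinant of high order. -/
lemma det_mem_pow_of_expansion {ι γ R : Type*} [CommRing R] [Fintype ι] [DecidableEq ι]
    (I : Ideal R) (c : ι → γ) (e n : γ → ℕ) (J : ℕ) (z : ι → ℕ → R) (b : γ → ℕ → ι → R)
    (hz : ∀ i j, z i j ∈ I ^ (e (c i) * (n (c i) + j))) (w : ℕ)
    (hw : 2 * w ≤ ∑ i, (2 * (e (c i) * n (c i)) + e (c i) * classmates c Finset.univ i) + 1) :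
    (Matrix.of fun i x => ∑ j ∈ Finset.range J, z i j * b (c i) j x).det ∈ I ^ w := by
  have h1 : (Matrix.of fun i x => ∑ j ∈ Finset.range J, z i j * b (c i) j x).det
      = Matrix.detRowAlternating.toMultilinearMap
        (fun i => ∑ j ∈ Finset.range J, z i j • b (c i) j) := by
    change Matrix.det _ = Matrix.det _
    congr 1
    ext i x
    simp [Finset.sum_apply]
  rw [h1, MultilinearMap.map_sum_finset]
  refine Ideal.sum_mem _ fun r _ => ?_
  rw [MultilinearMap.map_smul_univ, smul_eq_mul]
  -- Either `r` separates the members of each class and the coefficients have high order, or two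
  -- rows coincide and the term vanishes.
  by_cases hr : ∀ i i', c i = c i' → r i = r i' → i = i'
  · have hprod : ∏ i, z i (r i) ∈ I ^ (∑ i, e (c i) * (n (c i) + r i)) := by
      rw [← Finset.prod_pow_eq_pow_sum]
      exact Ideal.prod_mem_prod fun i _ => hz i (r i)
    refine Ideal.mul_mem_right _ _ (Ideal.pow_le_pow_right ?_ hprod)
    have := sum_mul_classmates_le c e Finset.univ r (fun i _ i' _ => hr i i')
    simp only [mul_add, Finset.sum_add_distrib, ← Finset.mul_sum] at hw ⊢
    omega
  · push Not at hr
    obtain ⟨i, i', hc, hrr, hne⟩ := hr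
    have : Matrix.detRowAlternating.toMultilinearMap (fun i => b (c i) (r i)) = 0 := by
      refine Matrix.det_zero_of_row_eq (R := R) hne ?_
      simp [hc, hrr]
    rw [this, mul_zero]
    exact Ideal.zero_mem _

lemma det_sub_det_mem {ι R : Type*} [CommRing R] [Fintype ι] [DecidableEq ι] (I : Ideal R)
    (A B : Matrix ι ι R) (h : ∀ i j, A i j - B i j ∈ I) : A.det - B.det ∈ I := by
  rw [← Ideal.Quotient.eq, RingHom.map_det, RingHom.map_det]
  congr 1
  ext i j
  exact Ideal.Quotient.eq.2 (h i j)

lemma sq_det_mem_pow {ι γ R : Type*} [CommRing R] [Fintype ι] [DecidableEq ι]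
    (I : Ideal R) (c : ι → γ) (e n : γ → ℕ) (J N : ℕ) (z : ι → ℕ → R) (b : γ → ℕ → ι → R)
    (M : Matrix ι ι R)
    (hz : ∀ i j, z i j ∈ I ^ (e (c i) * (n (c i) + j)))
    (hM : ∀ i x, M i x - ∑ j ∈ Finset.range J, z i j * b (c i) j x ∈ I ^ N)
    (hN : ∑ i, (2 * (e (c i) * n (c i)) + e (c i) * classmates c Finset.univ i) ≤ N) :
    M.det ^ 2 ∈ I ^ ∑ i, (2 * (e (c i) * n (c i)) + e (c i) * classmates c Finset.univ i) := by
  set W := ∑ i, (2 * (e (c i) * n (c i)) + e (c i) * classmates c Finset.univ i) with hW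
  -- Rounding `W / 2` up lets the square reach `W` without a proof that `W` is even.
  have h1 := det_mem_pow_of_expansion I c e n J z b hz ((W + 1) / 2) (by omega)
  have h2 := det_sub_det_mem (I ^ N) M
    (Matrix.of fun i x => ∑ j ∈ Finset.range J, z i j * b (c i) j x) hM
  have h3 : M.det ∈ I ^ ((W + 1) / 2) := by
    have := Ideal.add_mem _ (Ideal.pow_le_pow_right (show (W + 1) / 2 ≤ N by omega) h2) h1
    rwa [sub_add_cancel] at this
  have h4 := Ideal.pow_mem_pow h3 2
  rw [← pow_mul] at h4
  exact Ideal.pow_le_pow_right (by omega) h4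

/-! ### Double counting over `m`-element subsets. -/

open Classical in
/-- The number of `m`-element subsets that contain a given set `t`. -/
lemma card_subsets_containing {α : Type*} [Fintype α] (m : ℕ) (t : Finset α)
    (ht : t.card ≤ m) :
    ((Finset.univ.powersetCard m).filter fun S : Finset α => t ⊆ S).card
      = (Fintype.card α - t.card).choose (m - t.card) := by
  rw [Finset.card_filter_powersetCard_subset t Finset.univ m (Finset.subset_univ t) ht]
  rfl

open Classical in
lemma sum_powersetCard_sum {α : Type*} [Fintype α] (m : ℕ) (h1 : 1 ≤ m)
    (g : α → ℕ) :
    ∑ S ∈ (Finset.univ : Finset α).powersetCard m, ∑ i ∈ S, g i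
      = (Fintype.card α - 1).choose (m - 1) * ∑ i, g i := by
  have : ∀ S : Finset α, ∑ i ∈ S, g i = ∑ i, if i ∈ S then g i else 0 := fun S => by
    rw [← Finset.sum_filter, Finset.filter_univ_mem]
  rw [Finset.sum_congr rfl fun S _ => this S, Finset.sum_comm, Finset.mul_sum]
  refine Finset.sum_congr rfl fun i _ => ?_
  rw [← Finset.sum_filter, Finset.sum_const, smul_eq_mul]
  congr 1
  simpa using card_subsets_containing m {i} (by simpa using h1)

-- Each ordered pair of distinct indices of one class is counted once for every `S` containing both.
open Classical in
lemma sum_powersetCard_classmates {α γ : Type*} [Fintype α] (m : ℕ) (h2 : 2 ≤ m)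
    (c : α → γ) (g : α → ℕ) :
    ∑ S ∈ (Finset.univ : Finset α).powersetCard m, ∑ i ∈ S, g i * classmates c S i
      = (Fintype.card α - 2).choose (m - 2) * ∑ i, g i * classmates c Finset.univ i := by
  have key : ∀ S : Finset α, ∑ i ∈ S, g i * classmates c S i
      = ∑ i, ∑ i', if i' ≠ i ∧ c i' = c i then (if {i, i'} ⊆ S then g i else 0) else 0 := by
    intro S
    have : ∀ i, (∑ i', if i' ≠ i ∧ c i' = c i then (if {i, i'} ⊆ S then g i else 0) else 0)
        = if i ∈ S then g i * classmates c S i else 0 := by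
      intro i
      split_ifs with hi
      · rw [classmates, Finset.card_filter, Finset.mul_sum,
          ← Finset.sum_subset (Finset.subset_univ S)]
        · refine Finset.sum_congr rfl fun i' hi' => ?_
          simp [Finset.insert_subset_iff, hi, hi']
        · intro i' _ hi'
          simp [Finset.insert_subset_iff, hi']
      · simp [Finset.insert_subset_iff, hi]
    simp only [this]
    rw [← Finset.sum_filter, Finset.filter_univ_mem]
  rw [Finset.sum_congr rfl fun S _ => key S, Finset.sum_comm, Finset.mul_sum]
  refine Finset.sum_congr rfl fun i _ => ?_
  rw [Finset.sum_comm, classmates, Finset.card_filter, Finset.mul_sum, Finset.mul_sum]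
  refine Finset.sum_congr rfl fun i' _ => ?_
  split_ifs with h
  · rw [← Finset.sum_filter, Finset.sum_const, smul_eq_mul, mul_one]
    congr 1
    have hc : ({i, i'} : Finset α).card = 2 := Finset.card_pair (Ne.symm h.1)
    have := card_subsets_containing m {i, i'} (by omega)
    rwa [hc] at this
  · simp

/-! ### Orders of ideals at a prime of a Dedekind domain. -/

lemma map_ne_bot {A B : Type*} [CommRing A] [CommRing B] {f : A →+* B}
    (hf : Function.Injective f) {I : Ideal A} (hI : I ≠ ⊥) : I.map f ≠ ⊥ := fun h => hI ((Ideal.map_eq_bot_iff_of_injective hf).1 h)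

section Order

variable {B : Type*} [CommRing B] [IsDedekindDomain B]

open Classical in
/-- The exponent of `Q` in the factorization of the ideal `I`. -/
def ord (Q I : Ideal B) : ℕ := (UniqueFactorizationMonoid.normalizedFactors I).count Q

lemma ord_mul (Q : Ideal B) {I J : Ideal B} (hI : I ≠ ⊥) (hJ : J ≠ ⊥) :
    ord Q (I * J) = ord Q I + ord Q J := by
  unfold ord
  rw [UniqueFactorizationMonoid.normalizedFactors_mul hI hJ, Multiset.count_add]

lemma ord_pow (Q : Ideal B) (I : Ideal B) (n : ℕ) : ord Q (I ^ n) = n * ord Q I := by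
  unfold ord
  rw [UniqueFactorizationMonoid.normalizedFactors_pow, Multiset.count_nsmul]

lemma ord_top (Q : Ideal B) : ord Q ⊤ = 0 := by
  unfold ord
  rw [← Ideal.one_eq_top, UniqueFactorizationMonoid.normalizedFactors_one, Multiset.count_zero]

lemma ord_prod {ι : Type*} (Q : Ideal B) (s : Finset ι) (I : ι → Ideal B)
    (hI : ∀ i ∈ s, I i ≠ ⊥) : ord Q (∏ i ∈ s, I i) = ∑ i ∈ s, ord Q (I i) := by
  classical
  induction s using Finset.induction_on with
  | empty => simp [ord_top]
  | insert a s ha ih =>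
    rw [Finset.prod_insert ha, Finset.sum_insert ha, ord_mul, ih]
    · exact fun i hi => hI i (Finset.mem_insert_of_mem hi)
    · exact hI a (Finset.mem_insert_self _ _)
    · exact Finset.prod_ne_zero_iff.2 fun i hi => hI i (Finset.mem_insert_of_mem hi)

lemma le_pow_iff_le_ord {Q I : Ideal B} [hQ : Q.IsPrime] (hQ0 : Q ≠ ⊥) (hI : I ≠ ⊥) (n : ℕ) :
    I ≤ Q ^ n ↔ n ≤ ord Q I := by
  classical
  have hirr : Irreducible Q := (Ideal.prime_of_isPrime hQ0 hQ).irreducible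
  rw [← Ideal.dvd_iff_le, pow_dvd_iff_le_emultiplicity,
    UniqueFactorizationMonoid.emultiplicity_eq_count_normalizedFactors hirr hI]
  unfold ord
  rw [normalize_eq Q, Nat.cast_le]

lemma le_pow_ord (Q I : Ideal B) [Q.IsPrime] (hQ0 : Q ≠ ⊥) : I ≤ Q ^ ord Q I := by
  rcases eq_or_ne I ⊥ with rfl | hI
  · exact bot_le
  · exact (le_pow_iff_le_ord hQ0 hI _).2 le_rfl

lemma ord_eq_zero {Q I : Ideal B} [Q.IsPrime] (hQ0 : Q ≠ ⊥) (hI : I ≠ ⊥) (h : ¬ I ≤ Q) :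
    ord Q I = 0 := by
  by_contra h0
  exact h (by simpa using (le_pow_iff_le_ord hQ0 hI 1).2 (Nat.one_le_iff_ne_zero.2 h0))

lemma ord_pos {Q I : Ideal B} [Q.IsPrime] (hQ0 : Q ≠ ⊥) (hI : I ≠ ⊥) (h : I ≤ Q) :
    0 < ord Q I :=
  (le_pow_iff_le_ord hQ0 hI 1).1 (by simpa using h)

lemma exists_eq_pow_ord_mul {Q I : Ideal B} [Q.IsPrime] (hQ0 : Q ≠ ⊥) (hI : I ≠ ⊥) :
    ∃ J : Ideal B, I = Q ^ ord Q I * J ∧ ¬ J ≤ Q := by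
  obtain ⟨J, hJ⟩ := Ideal.dvd_iff_le.2 (le_pow_ord Q I hQ0)
  refine ⟨J, hJ, fun h => ?_⟩
  have : I ≤ Q ^ (ord Q I + 1) := by
    conv_lhs => rw [hJ]
    rw [pow_succ]
    exact Ideal.mul_mono_right h
  have := (le_pow_iff_le_ord hQ0 hI _).1 this
  omega

lemma le_of_forall_le_pow_ord {I J : Ideal B} (hI : I ≠ ⊥)
    (h : ∀ Q : Ideal B, Q.IsPrime → Q ≠ ⊥ → J ≤ Q ^ ord Q I) : J ≤ I := by
  classical
  rcases eq_or_ne J ⊥ with rfl | hJ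
  · exact bot_le
  rw [← Ideal.dvd_iff_le,
    UniqueFactorizationMonoid.dvd_iff_normalizedFactors_le_normalizedFactors hI hJ,
    Multiset.le_iff_count]
  intro Q
  by_cases hQ : Q ∈ UniqueFactorizationMonoid.normalizedFactors I
  · have hp := UniqueFactorizationMonoid.prime_of_normalized_factor Q hQ
    have := Ideal.isPrime_of_prime hp
    have := (le_pow_iff_le_ord hp.ne_zero hJ _).1 (h Q this hp.ne_zero)
    unfold ord at this
    convert this
  · rw [Multiset.count_eq_zero_of_notMem hQ]
    exact Nat.zero_le _

variable {A : Type*} [CommRing A] [IsDedekindDomain A]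

/-- Split off the full power of `P = Q.comap f` from `I`; the cofactor is not contained in `P`, so
its extension is not contained in `Q`. -/
lemma ord_map {f : A →+* B} (hf : Function.Injective f) {Q : Ideal B} [Q.IsPrime]
    (hQ0 : Q ≠ ⊥) (hP0 : Q.comap f ≠ ⊥) {I : Ideal A} (hI : I ≠ ⊥) :
    ord Q (I.map f) = ord (Q.comap f) I * ord Q ((Q.comap f).map f) := by
  obtain ⟨J, hJ, hJP⟩ := exists_eq_pow_ord_mul hP0 hI
  have hJ0 : J ≠ ⊥ := by
    rintro rfl
    exact hJP bot_le
  conv_lhs => rw [hJ]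
  rw [Ideal.map_mul, Ideal.map_pow, ord_mul Q (pow_ne_zero _ (map_ne_bot hf hP0))
    (map_ne_bot hf hJ0), ord_pow, ord_eq_zero hQ0 (map_ne_bot hf hJ0), add_zero]
  rwa [Ideal.map_le_iff_le_comap]

end Order

/-! ### Digit expansions modulo powers of a prime. -/

section Digits

variable {B : Type*} [CommRing B]

/-- The cofactor of `a - b` in `a ^ q - b ^ q` is congruent to `q a ^ (q - 1)` modulo `Q`, hence
lies in `Q`. -/
lemma pow_sub_pow_mem_pow_succ {Q : Ideal B} {q i : ℕ} (hq : (q : B) ∈ Q) {a b : B}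
    (hi : 1 ≤ i) (h : a - b ∈ Q ^ i) : a ^ q - b ^ q ∈ Q ^ (i + 1) := by
  rw [← geom_sum₂_mul, mul_comm, pow_succ]
  refine Ideal.mul_mem_mul h ?_
  have hab : Ideal.Quotient.mk Q a = Ideal.Quotient.mk Q b :=
    Ideal.Quotient.eq.2 (Ideal.pow_le_self (by omega) h)
  rw [← Ideal.Quotient.eq_zero_iff_mem, RingHom.map_geom_sum₂, hab, geom_sum₂_self,
    ← map_natCast (Ideal.Quotient.mk Q), Ideal.Quotient.eq_zero_iff_mem.2 hq, zero_mul]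

lemma pow_pow_sub_pow_pow_mem {Q : Ideal B} {q : ℕ} (hq : (q : B) ∈ Q) {a b : B}
    (h : a - b ∈ Q) (K : ℕ) : a ^ q ^ K - b ^ q ^ K ∈ Q ^ (K + 1) := by
  induction K with
  | zero => simpa using h
  | succ K ih =>
    rw [pow_succ q, pow_mul, pow_mul]
    exact pow_sub_pow_mem_pow_succ hq (by omega) ih

lemma sub_pow_pow_mem {P : Ideal B} {q : ℕ} (hq : ∀ y, y - y ^ q ∈ P) (y : B) (K : ℕ) :
    y - y ^ q ^ K ∈ P := by
  induction K with
  | zero => simp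
  | succ K ih =>
    have := P.add_mem ih (hq (y ^ q ^ K))
    rwa [sub_add_sub_cancel, ← pow_mul, ← pow_succ] at this

/-- Expansion in powers of a uniformizer, with digits that are `q ^ K`-th powers. -/
lemma exists_digits [IsDedekindDomain B] {P : Ideal B} [P.IsPrime] (hP : P ≠ ⊥) {q : ℕ}
    (hq : ∀ y, y - y ^ q ∈ P) {π : B} (hπ : π ∈ P) (hπ2 : π ∉ P ^ 2) (K n M : ℕ) {x : B}
    (hx : x ∈ P ^ n) :
    ∃ y : ℕ → B, x - ∑ j ∈ Finset.range M, π ^ (n + j) * y j ^ q ^ K ∈ P ^ (n + M) := by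
  have hπn : ∀ i, π ^ i ∉ P ^ (i + 1) := by
    intro i hi
    have hπ0 : π ≠ 0 := by
      rintro rfl
      exact hπ2 (Ideal.zero_mem _)
    have h0 : Ideal.span {π} ≠ ⊥ := by simpa using hπ0
    have h1 : ord P (Ideal.span {π}) ≤ 1 := by
      by_contra h
      exact hπ2 ((le_pow_iff_le_ord hP h0 2).2 (by omega) (Ideal.mem_span_singleton_self _))
    have h2 : Ideal.span {π} ^ i ≤ P ^ (i + 1) := by
      rw [Ideal.span_singleton_pow]
      exact (Ideal.span_singleton_le_iff_mem _).2 hi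
    have h3 := (le_pow_iff_le_ord hP (pow_ne_zero i h0) _).1 h2
    rw [ord_pow] at h3
    nlinarith
  induction M with
  | zero => exact ⟨0, by simpa using hx⟩
  | succ M ih =>
    obtain ⟨y, hy⟩ := ih
    -- The next digit `d` may be replaced by `d ^ q ^ K`: they agree modulo `P`, so the error has
    -- order one higher.
    obtain ⟨d, e, he, hde⟩ := Ideal.exists_mul_add_mem_pow_succ hP (π ^ (n + M)) _
      (Ideal.pow_mem_pow hπ _) (hπn _) hy
    refine ⟨Function.update y M d, ?_⟩
    rw [Finset.sum_range_succ, Function.update_self, ← sub_sub,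
      Finset.sum_congr rfl (g := fun j => π ^ (n + j) * y j ^ q ^ K), ← hde]
    · have : π ^ (n + M) * (d - d ^ q ^ K) ∈ P ^ (n + M + 1) := by
        rw [pow_succ P]
        exact Ideal.mul_mem_mul (Ideal.pow_mem_pow hπ _) (sub_pow_pow_mem hq d K)
      have := Ideal.add_mem _ this he
      rw [← add_assoc n M 1]
      convert this using 1
      ring
    · intro j hj
      rw [Function.update_of_ne (Finset.mem_range.1 hj).ne]

end Digits

/-! ### Residue maps and the local bound for one minor. -/

open NumberField

variable {k L : Type*} [Field k] [NumberField k] [Field L] [NumberField L]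

/-- The residue map attached to an embedding of rings of integers and a prime of the target. -/
def residueMap (Q : Ideal (𝓞 L)) (f : 𝓞 k →+* 𝓞 L) : 𝓞 k →+* 𝓞 L ⧸ Q :=
  (Ideal.Quotient.mk Q).comp f

lemma ker_residueMap {k L : Type*} [Field k] [Field L]
    (Q : Ideal (𝓞 L)) (f : 𝓞 k →+* 𝓞 L) :
    RingHom.ker (residueMap Q f) = Q.comap f := by
  rw [residueMap, ← RingHom.comap_ker, Ideal.mk_ker]

/-- The relative ramification index of `Q` with respect to a residue map. -/
def relRam (Q : Ideal (𝓞 L)) (p : ℕ) (c : 𝓞 k →+* 𝓞 L ⧸ Q) : ℕ :=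
  ord Q (Ideal.span {(p : 𝓞 L)}) / ord (RingHom.ker c) (Ideal.span {(p : 𝓞 k)})

lemma span_natCast_ne_bot {p : ℕ} (hp : p ≠ 0) : Ideal.span {(p : 𝓞 k)} ≠ ⊥ := by
  simpa using hp

lemma natCast_mem_comap {k L : Type*} [Field k] [Field L]
    {Q : Ideal (𝓞 L)} {p : ℕ} (hpQ : (p : 𝓞 L) ∈ Q) (f : 𝓞 k →+* 𝓞 L) :
    (p : 𝓞 k) ∈ Q.comap f := by
  simpa [Ideal.mem_comap] using hpQ

lemma comap_ne_bot {k L : Type*} [Field k] [NumberField k] [Field L]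
    {Q : Ideal (𝓞 L)} {p : ℕ} (hp : p ≠ 0) (hpQ : (p : 𝓞 L) ∈ Q)
    (f : 𝓞 k →+* 𝓞 L) : Q.comap f ≠ ⊥ := fun h => by
  have := natCast_mem_comap hpQ f
  rw [h, Ideal.mem_bot] at this
  exact hp (by exact_mod_cast this)

lemma ord_comap_mul_ord_map {Q : Ideal (𝓞 L)} [Q.IsPrime] (hQ0 : Q ≠ ⊥) {p : ℕ} (hp : p ≠ 0)
    (hpQ : (p : 𝓞 L) ∈ Q) {f : 𝓞 k →+* 𝓞 L} (hf : Function.Injective f) :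
    ord (Q.comap f) (Ideal.span {(p : 𝓞 k)}) * ord Q ((Q.comap f).map f)
      = ord Q (Ideal.span {(p : 𝓞 L)}) := by
  rw [← ord_map hf hQ0 (comap_ne_bot hp hpQ f) (span_natCast_ne_bot hp), Ideal.map_span,
    Set.image_singleton, map_natCast]

/-- The quotient defining `relRam` is exact. That form makes the ramification index visibly a
function of the residue map, as a weight on classes must be. -/
lemma relRam_residueMap {Q : Ideal (𝓞 L)} [Q.IsPrime] (hQ0 : Q ≠ ⊥) {p : ℕ} (hp : p ≠ 0)
    (hpQ : (p : 𝓞 L) ∈ Q) {f : 𝓞 k →+* 𝓞 L} (hf : Function.Injective f) :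
    relRam Q p (residueMap Q f) = ord Q ((Q.comap f).map f) := by
  rw [relRam, ker_residueMap, ← ord_comap_mul_ord_map hQ0 hp hpQ hf]
  refine Nat.mul_div_cancel_left _ (ord_pos (comap_ne_bot hp hpQ f) (span_natCast_ne_bot hp) ?_)
  exact (Ideal.span_singleton_le_iff_mem _).2 (natCast_mem_comap hpQ f)

lemma sub_pow_absNorm_mem (P : Ideal (𝓞 k)) [P.IsPrime] (hP : P ≠ ⊥) (y : 𝓞 k) :
    y - y ^ Ideal.absNorm P ∈ P := by
  have : P.IsMaximal := Ideal.IsPrime.isMaximal ‹_› hP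
  let _ : Field (𝓞 k ⧸ P) := Ideal.Quotient.field P
  have : Finite (𝓞 k ⧸ P) := Ideal.finiteQuotientOfFreeOfNeBot P hP
  let _ : Fintype (𝓞 k ⧸ P) := Fintype.ofFinite _
  rw [← Ideal.Quotient.eq, map_pow, Ideal.absNorm_apply, Submodule.cardQuot_apply,
    Nat.card_eq_fintype_card, FiniteField.pow_card]

open Classical in
theorem sq_det_mem_pow_ord {ι : Type*} [Fintype ι] (Q : Ideal (𝓞 L)) [Q.IsPrime] (hQ0 : Q ≠ ⊥)
    {p : ℕ} (hp : p ≠ 0) (hpQ : (p : 𝓞 L) ∈ Q) (f : ι → 𝓞 k →+* 𝓞 L)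
    (hf : ∀ i, Function.Injective (f i)) (𝔫 : Ideal (𝓞 k)) (x : ι → 𝓞 k)
    (hx : ∀ j, x j ∈ 𝔫) :
    (Matrix.of fun i j => f i (x j)).det ^ 2 ∈ Q ^ ∑ i,
      (2 * (relRam Q p (residueMap Q (f i)) * ord (RingHom.ker (residueMap Q (f i))) 𝔫)
        + relRam Q p (residueMap Q (f i))
          * classmates (fun i => residueMap Q (f i)) Finset.univ i) := by
  set W := ∑ i,
      (2 * (relRam Q p (residueMap Q (f i)) * ord (RingHom.ker (residueMap Q (f i))) 𝔫)
        + relRam Q p (residueMap Q (f i))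
          * classmates (fun i => residueMap Q (f i)) Finset.univ i) with hW
  -- The uniformizer and digits are chosen from `P` alone, so embeddings with the same residue map,
  -- hence the same kernel, share them.
  have hdig : ∀ P : Ideal (𝓞 k), P.IsPrime → P ≠ ⊥ → ∃ (π : 𝓞 k) (y : 𝓞 k → ℕ → 𝓞 k), π ∈ P ∧
      ∀ x ∈ 𝔫, x - ∑ j ∈ Finset.range W, π ^ (ord P 𝔫 + j) * y x j ^ Ideal.absNorm P ^ W
        ∈ P ^ (ord P 𝔫 + W) := by
    intro P hP hP0
    obtain ⟨π, hπ, hπ2⟩ := Ideal.exists_mem_pow_notMem_pow_succ P hP0 hP.ne_top 1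
    rw [pow_one] at hπ
    have := fun x (hx : x ∈ 𝔫) => exists_digits hP0 (sub_pow_absNorm_mem P hP0) hπ hπ2 W
      (ord P 𝔫) W (le_pow_ord P 𝔫 hP0 hx)
    choose! y hy using this
    exact ⟨π, y, hπ, hy⟩
  choose! π y hπ hy using hdig
  -- Precision `W` suffices, as `W` is the exponent to be reached. In the common vectors each
  -- conjugate digit is replaced by a fixed lift of its residue.
  refine sq_det_mem_pow Q (fun i => residueMap Q (f i)) (relRam Q p)
    (fun c => ord (RingHom.ker c) 𝔫) W W
    (fun i j => f i (π (Q.comap (f i))) ^ (ord (Q.comap (f i)) 𝔫 + j))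
    (fun c j t => Quotient.out (c (y (RingHom.ker c) (x t) j))
      ^ Ideal.absNorm (RingHom.ker c) ^ W) _ ?_ ?_ le_rfl
  · intro i j
    have hP0 := comap_ne_bot hp hpQ (f i)
    rw [ker_residueMap, relRam_residueMap hQ0 hp hpQ (hf i), pow_mul]
    refine Ideal.pow_mem_pow (le_pow_ord Q _ hQ0 ?_) _
    exact Ideal.mem_map_of_mem _ (hπ _ inferInstance hP0)
  · intro i t
    have hP0 := comap_ne_bot hp hpQ (f i)
    simp only [ker_residueMap, Matrix.of_apply]
    set P := Q.comap (f i) with hP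
    have h1 := hy P inferInstance hP0 (x t) (hx t)
    have h2 : f i (x t) - ∑ j ∈ Finset.range W,
        f i (π P) ^ (ord P 𝔫 + j) * f i (y P (x t) j) ^ Ideal.absNorm P ^ W ∈ Q ^ W := by
      have := Ideal.mem_map_of_mem (f i) h1
      rw [Ideal.map_pow] at this
      have := Ideal.pow_right_mono (Ideal.map_le_iff_le_comap.2 hP.le) _ this
      simpa using Ideal.pow_le_pow_right (Nat.le_add_left W _) this
    have h3 : ∑ j ∈ Finset.range W, f i (π P) ^ (ord P 𝔫 + j) *
        (f i (y P (x t) j) ^ Ideal.absNorm P ^ W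
          - Quotient.out (residueMap Q (f i) (y P (x t) j)) ^ Ideal.absNorm P ^ W) ∈ Q ^ W := by
      refine Ideal.sum_mem _ fun j _ => Ideal.mul_mem_left _ _ ?_
      -- Elements congruent modulo `Q` have `q ^ W`-th powers congruent modulo `Q ^ (W + 1)`, where
      -- `q = absNorm P` lies in `Q`.
      refine Ideal.pow_le_pow_right (Nat.le_succ W) (pow_pow_sub_pow_pow_mem ?_ ?_ W)
      · have : (Ideal.absNorm P : 𝓞 k) ∈ P := Ideal.absNorm_mem P
        rw [hP, Ideal.mem_comap, map_natCast] at this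
        exact this
      · rw [← Ideal.Quotient.eq]
        exact (Ideal.Quotient.mk_out _).symm
    have := Ideal.add_mem _ h2 h3
    simp only [mul_sub, Finset.sum_sub_distrib] at this
    convert this using 1
    ring

/-! ### Norms as products of conjugates. -/

/-- By `hL`, following embeddings into `L` by `φ` yields every embedding into the algebraic closure.
-/
lemma prod_embeddings_eq_norm (hL : Fintype.card (k →+* L) = Module.finrank ℚ k) (a : k) :
    ∏ σ : k →+* L, σ a = algebraMap ℚ L (Algebra.norm ℚ a) := by
  let φ : L →+* AlgebraicClosure ℚ :=
    (IsAlgClosed.lift : L →ₐ[ℚ] AlgebraicClosure ℚ).toRingHom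
  have hinj : Function.Injective fun σ : k →+* L => φ.comp σ := fun σ τ h =>
    RingHom.ext fun x => φ.injective (RingHom.congr_fun h x)
  have hbij : Function.Bijective fun σ : k →+* L => φ.comp σ :=
    (Fintype.bijective_iff_injective_and_card _).2
      ⟨hinj, hL.trans (NumberField.Embeddings.card k (AlgebraicClosure ℚ)).symm⟩
  apply φ.injective
  rw [map_prod]
  have h1 := Algebra.norm_eq_prod_embeddings ℚ (AlgebraicClosure ℚ) a
  have h2 : φ (algebraMap ℚ L (Algebra.norm ℚ a))
      = algebraMap ℚ (AlgebraicClosure ℚ) (Algebra.norm ℚ a) := by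
    rw [eq_ratCast, eq_ratCast, map_ratCast]
  rw [h2, h1, ← (RingHom.equivRatAlgHom (R := k) (S := AlgebraicClosure ℚ)).prod_comp]
  exact Function.Bijective.prod_comp hbij fun τ : k →+* AlgebraicClosure ℚ => τ a

/-- The map on rings of integers induced by an embedding is injective. -/
lemma mapRingHom_injective {k L : Type*} [Field k] [Field L] (σ : k →+* L) :
    Function.Injective (RingOfIntegers.mapRingHom σ) :=
  fun x y h => RingOfIntegers.ext (σ.injective (by
    have := congrArg (fun z : 𝓞 L => (z : L)) h
    simpa using this))

lemma prod_mapRingHom_eq_norm (hL : Fintype.card (k →+* L) = Module.finrank ℚ k) (a : 𝓞 k) :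
    ∏ σ : k →+* L, RingOfIntegers.mapRingHom σ a = ((Algebra.norm ℤ a : ℤ) : 𝓞 L) := by
  apply RingOfIntegers.coe_injective
  rw [map_prod, map_intCast]
  have := prod_embeddings_eq_norm hL (a : k)
  rw [← Algebra.coe_norm_int, eq_ratCast, Rat.cast_intCast] at this
  exact this

/-- The class-number power of `𝔫` is principal, so the norm formula for elements applies; the factor
`h` then cancels in the orders. -/
lemma sum_ord_map_eq (hL : Fintype.card (k →+* L) = Module.finrank ℚ k) (Q : Ideal (𝓞 L))
    {𝔫 : Ideal (𝓞 k)} (h𝔫 : 𝔫 ≠ ⊥) :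
    ∑ σ : k →+* L, ord Q (𝔫.map (RingOfIntegers.mapRingHom σ))
      = ord Q (Ideal.span {(Ideal.absNorm 𝔫 : 𝓞 L)}) := by
  set h := Fintype.card (ClassGroup (𝓞 k)) with hh
  have hpos : 0 < h := Fintype.card_pos
  obtain ⟨a, ha⟩ : ∃ a, 𝔫 ^ h = Ideal.span {a} := by
    let I : nonZeroDivisors (Ideal (𝓞 k)) := ⟨𝔫, mem_nonZeroDivisors_of_ne_zero h𝔫⟩
    have h1 : ClassGroup.mk0 (I ^ h) = 1 := by
      rw [map_pow, hh, pow_card_eq_one]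
    have h2 := (ClassGroup.mk0_eq_one_iff (I ^ h).2).1 h1
    exact h2.principal
  have h1 : ∏ σ : k →+* L, (𝔫 ^ h).map (RingOfIntegers.mapRingHom σ)
      = Ideal.span {(Ideal.absNorm 𝔫 : 𝓞 L)} ^ h := by
    have hN : Ideal.absNorm 𝔫 ^ h = (Algebra.norm ℤ a).natAbs := by
      rw [← map_pow, ha, Ideal.absNorm_span_singleton]
    have hs : Ideal.span {(Ideal.absNorm 𝔫 : 𝓞 L)} ^ h
        = Ideal.span {((Algebra.norm ℤ a : ℤ) : 𝓞 L)} := by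
      rw [Ideal.span_singleton_pow, ← Nat.cast_pow, hN]
      rcases Int.natAbs_eq (Algebra.norm ℤ a) with h | h
      · conv_rhs => rw [h]
        rw [Int.cast_natCast]
      · conv_rhs => rw [h]
        rw [Int.cast_neg, Int.cast_natCast, Ideal.span_singleton_neg]
    rw [hs, ← prod_mapRingHom_eq_norm hL, ← Ideal.prod_span_singleton]
    refine Finset.prod_congr rfl fun σ _ => ?_
    rw [ha, Ideal.map_span, Set.image_singleton]
  have h2 := congrArg (ord Q) h1
  rw [ord_pow, ord_prod] at h2
  · simp only [Ideal.map_pow, ord_pow, ← Finset.mul_sum] at h2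
    exact Nat.eq_of_mul_eq_mul_left hpos h2
  · exact fun σ _ => map_ne_bot (mapRingHom_injective σ) (pow_ne_zero _ h𝔫)

/-! ### Embeddings over a prime and the tame bound. -/

lemma liesOver_span {k : Type*} [Field k] {P : Ideal (𝓞 k)} [hP : P.IsPrime] {p : ℕ} (hp : p.Prime)
    (h : (p : 𝓞 k) ∈ P) : P.LiesOver (Ideal.span {(p : ℤ)}) := by
  have hp' : Prime (p : ℤ) := Nat.prime_iff_prime_int.mp hp
  have hmax : (Ideal.span {(p : ℤ)}).IsMaximal :=
    PrincipalIdealRing.isMaximal_of_irreducible hp'.irreducible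
  refine ⟨hmax.eq_of_le (Ideal.IsPrime.under ℤ P).ne_top ?_⟩
  rw [Ideal.span_singleton_le_iff_mem, Ideal.mem_under]
  simpa using h

lemma ord_span_natCast_pow (Q : Ideal (𝓞 L)) (p n : ℕ) :
    ord Q (Ideal.span {((p ^ n : ℕ) : 𝓞 L)}) = n * ord Q (Ideal.span {(p : 𝓞 L)}) := by
  rw [Nat.cast_pow, ← Ideal.span_singleton_pow, ord_pow]

/-- At most `f_P` residue maps have kernel `P`. -/
lemma card_residueMaps_le {Q : Ideal (𝓞 L)} [hQ : Q.IsPrime] (hQ0 : Q ≠ ⊥) {p : ℕ}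
    (hp : p.Prime) (hpQ : (p : 𝓞 L) ∈ Q) {P : Ideal (𝓞 k)} [hP : P.IsPrime] (hP0 : P ≠ ⊥)
    (hpP : (p : 𝓞 k) ∈ P) (s : Finset (𝓞 k →+* 𝓞 L ⧸ Q)) (hs : ∀ c ∈ s, RingHom.ker c = P) :
    s.card ≤ P.inertiaDeg ℤ := by
  have := liesOver_span hp hpQ
  have := liesOver_span hp hpP
  have hmax : (Ideal.span {(p : ℤ)}).IsMaximal :=
    PrincipalIdealRing.isMaximal_of_irreducible (Nat.prime_iff_prime_int.mp hp).irreducible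
  have : P.IsMaximal := hP.isMaximal hP0
  have : Q.IsMaximal := hQ.isMaximal hQ0
  let _ : Field (ℤ ⧸ Ideal.span {(p : ℤ)}) := Ideal.Quotient.field _
  let _ : Field (𝓞 k ⧸ P) := Ideal.Quotient.field _
  let _ : Field (𝓞 L ⧸ Q) := Ideal.Quotient.field _
  rw [Ideal.inertiaDeg_eq_of_isMaximal (Ideal.span {(p : ℤ)}) P]
  have : Module.Finite (ℤ ⧸ Ideal.span {(p : ℤ)}) (𝓞 k ⧸ P) := inferInstance
  refine le_trans ?_ (card_algHom_le_finrank (ℤ ⧸ Ideal.span {(p : ℤ)}) (𝓞 k ⧸ P) (𝓞 L ⧸ Q))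
  -- Residue maps with kernel `P` factor through the residue field, and such homomorphisms over the
  -- prime field number at most its degree.
  let F : s → (𝓞 k ⧸ P →ₐ[ℤ ⧸ Ideal.span {(p : ℤ)}] 𝓞 L ⧸ Q) := fun c =>
    { Ideal.Quotient.lift P c.1 (fun a ha => by rwa [← RingHom.mem_ker, hs c.1 c.2]) with
      commutes' := fun r => by
        obtain ⟨r, rfl⟩ := Ideal.Quotient.mk_surjective r
        rw [eq_intCast (Ideal.Quotient.mk _) r, map_intCast, map_intCast]
        exact map_intCast (Ideal.Quotient.lift P c.1 _) r }
  have hF : Function.Injective F := fun c d h => by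
    refine Subtype.ext (RingHom.ext fun x => ?_)
    exact DFunLike.congr_fun h (Ideal.Quotient.mk P x)
  simpa using Nat.card_le_card_of_injective F hF

/-- The residue map at `Q` of an embedding of number fields. -/
abbrev resMap (k : Type*) [Field k] (Q : Ideal (𝓞 L)) (σ : k →+* L) : 𝓞 k →+* 𝓞 L ⧸ Q :=
  residueMap Q (RingOfIntegers.mapRingHom σ)

/-- The order at `Q` of a conjugate of the ideal `𝔫`. -/
lemma ord_map_mapRingHom {Q : Ideal (𝓞 L)} [Q.IsPrime] (hQ0 : Q ≠ ⊥) {p : ℕ} (hp : p.Prime)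
    (hpQ : (p : 𝓞 L) ∈ Q) {𝔫 : Ideal (𝓞 k)} (h𝔫 : 𝔫 ≠ ⊥) (σ : k →+* L) :
    ord Q (𝔫.map (RingOfIntegers.mapRingHom σ))
      = relRam Q p (resMap k Q σ) * ord (RingHom.ker (resMap k Q σ)) 𝔫 := by
  have hf := mapRingHom_injective σ
  rw [relRam_residueMap hQ0 hp.ne_zero hpQ hf, ker_residueMap,
    ord_map hf hQ0 (comap_ne_bot hp.ne_zero hpQ _) h𝔫, mul_comm]

lemma sum_relRam_mul_ord (hL : Fintype.card (k →+* L) = Module.finrank ℚ k)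
    {Q : Ideal (𝓞 L)} [Q.IsPrime] (hQ0 : Q ≠ ⊥) {p : ℕ} (hp : p.Prime)
    (hpQ : (p : 𝓞 L) ∈ Q) {𝔫 : Ideal (𝓞 k)} (h𝔫 : 𝔫 ≠ ⊥) :
    ∑ σ : k →+* L, relRam Q p (resMap k Q σ) * ord (RingHom.ker (resMap k Q σ)) 𝔫
      = ord Q (Ideal.span {(Ideal.absNorm 𝔫 : 𝓞 L)}) := by
  rw [← sum_ord_map_eq hL Q h𝔫]
  exact Finset.sum_congr rfl fun σ _ => (ord_map_mapRingHom hQ0 hp hpQ h𝔫 σ).symm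

lemma ord_self_prime {P : Ideal (𝓞 k)} [hP : P.IsPrime] (hP0 : P ≠ ⊥) : ord P P = 1 := by
  classical
  unfold ord
  rw [UniqueFactorizationMonoid.normalizedFactors_irreducible
    (Ideal.prime_of_isPrime hP0 hP).irreducible, normalize_eq, Multiset.count_singleton_self]

open Classical in
/-- The embeddings over a fixed prime `P`, weighted by ramification. -/
lemma sum_relRam_fiber (hL : Fintype.card (k →+* L) = Module.finrank ℚ k)
    {Q : Ideal (𝓞 L)} [hQ : Q.IsPrime] (hQ0 : Q ≠ ⊥) {p : ℕ} (hp : p.Prime)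
    (hpQ : (p : 𝓞 L) ∈ Q) {P : Ideal (𝓞 k)} [hP : P.IsPrime] (hP0 : P ≠ ⊥)
    (hpP : (p : 𝓞 k) ∈ P) :
    ∑ σ : k →+* L with RingHom.ker (resMap k Q σ) = P, relRam Q p (resMap k Q σ)
      = P.inertiaDeg ℤ * ord Q (Ideal.span {(p : 𝓞 L)}) := by
  have := liesOver_span hp hpP
  -- Taking `𝔫 = P` isolates the fibre: the order of `P` is 1 at `P` and 0 at every other kernel.
  have h1 := sum_relRam_mul_ord hL hQ0 hp hpQ hP0
  rw [← Ideal.pow_inertiaDeg p P, ord_span_natCast_pow] at h1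
  rw [← h1, Finset.sum_filter]
  refine Finset.sum_congr rfl fun σ _ => ?_
  have hk : RingHom.ker (resMap k Q σ) = Q.comap (RingOfIntegers.mapRingHom σ) :=
    ker_residueMap Q _
  have hk0 := comap_ne_bot hp.ne_zero hpQ (RingOfIntegers.mapRingHom σ)
  have hkp : (Q.comap (RingOfIntegers.mapRingHom σ)).IsPrime := inferInstance
  rw [← hk] at hk0 hkp
  split_ifs with h
  · rw [h, ord_self_prime hP0, mul_one]
  · rw [ord_eq_zero hk0 hP0, mul_zero]
    intro hle
    exact h ((hP.isMaximal hP0).eq_of_le hkp.ne_top hle).symm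

-- On the fibre `relRam` is a constant `e`, and the right side is `e` times the sum of squared class
-- sizes. Cauchy–Schwarz with at most `f_P` classes, together with `s.card * e = f_P * E`, gives the
-- bound.
open Classical in
lemma sum_relRam_mul_card_fiber (hL : Fintype.card (k →+* L) = Module.finrank ℚ k)
    {Q : Ideal (𝓞 L)} [hQ : Q.IsPrime] (hQ0 : Q ≠ ⊥) {p : ℕ} (hp : p.Prime)
    (hpQ : (p : 𝓞 L) ∈ Q) {P : Ideal (𝓞 k)} [hP : P.IsPrime] (hP0 : P ≠ ⊥)
    (hpP : (p : 𝓞 k) ∈ P) :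
    (Finset.univ.filter fun σ : k →+* L => RingHom.ker (resMap k Q σ) = P).card
        * ord Q (Ideal.span {(p : 𝓞 L)})
      ≤ ∑ σ : k →+* L with RingHom.ker (resMap k Q σ) = P, relRam Q p (resMap k Q σ)
        * (classmates (resMap k Q) Finset.univ σ + 1) := by
  have hfib := sum_relRam_fiber hL hQ0 hp hpQ hP0 hpP
  set s := Finset.univ.filter fun σ : k →+* L => RingHom.ker (resMap k Q σ) = P with hs
  set E := ord Q (Ideal.span {(p : 𝓞 L)}) with hE
  set e := E / ord P (Ideal.span {(p : 𝓞 k)}) with he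
  have hrel : ∀ σ ∈ s, relRam Q p (resMap k Q σ) = e := fun σ hσ => by
    rw [relRam, (Finset.mem_filter.1 hσ).2]
  rw [Finset.sum_congr rfl hrel, Finset.sum_const, smul_eq_mul] at hfib
  rw [Finset.sum_congr rfl (fun σ hσ => by rw [hrel σ hσ] :
    ∀ σ ∈ s, relRam Q p (resMap k Q σ) * (classmates (resMap k Q) Finset.univ σ + 1)
      = e * (classmates (resMap k Q) Finset.univ σ + 1)), ← Finset.mul_sum]
  have hcl : ∀ σ ∈ s, classmates (resMap k Q) Finset.univ σ + 1
      = (s.filter fun τ => resMap k Q τ = resMap k Q σ).card := by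
    intro σ hσ
    have hmem : σ ∈ s.filter fun τ => resMap k Q τ = resMap k Q σ :=
      Finset.mem_filter.2 ⟨hσ, rfl⟩
    rw [← Finset.card_erase_add_one hmem, classmates]
    congr 2
    ext τ
    simp only [Finset.mem_filter, Finset.mem_erase, Finset.mem_univ, true_and]
    refine ⟨fun h => ⟨h.1, Finset.mem_filter.2 ⟨Finset.mem_univ _, ?_⟩, h.2⟩,
      fun h => ⟨h.1, h.2.2⟩⟩
    rw [h.2, (Finset.mem_filter.1 hσ).2]
  set C := s.image (resMap k Q) with hC
  have hmap : ∀ σ ∈ s, resMap k Q σ ∈ C := fun σ hσ => Finset.mem_image_of_mem _ hσ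
  have hsq : ∑ σ ∈ s, (classmates (resMap k Q) Finset.univ σ + 1)
      = ∑ c ∈ C, (s.filter fun τ => resMap k Q τ = c).card ^ 2 := by
    rw [Finset.sum_congr rfl hcl, ← Finset.sum_fiberwise_of_maps_to hmap]
    refine Finset.sum_congr rfl fun c _ => ?_
    rw [sq, ← smul_eq_mul, ← Finset.sum_const]
    exact Finset.sum_congr rfl fun σ hσ => by rw [(Finset.mem_filter.1 hσ).2]
  have hcard : s.card = ∑ c ∈ C, (s.filter fun τ => resMap k Q τ = c).card :=
    Finset.card_eq_sum_card_fiberwise hmap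
  have hCle : C.card ≤ P.inertiaDeg ℤ := by
    refine card_residueMaps_le hQ0 hp hpQ hP0 hpP C fun c hc => ?_
    obtain ⟨σ, hσ, rfl⟩ := Finset.mem_image.1 hc
    exact (Finset.mem_filter.1 hσ).2
  have hcs := sq_sum_le_card_mul_sum_sq (s := C)
    (f := fun c => (s.filter fun τ => resMap k Q τ = c).card)
  rw [← hcard, ← hsq] at hcs
  have hpos : 0 < P.inertiaDeg ℤ := by
    have := liesOver_span hp hpP
    have h1 := Ideal.pow_inertiaDeg p P
    rcases Nat.eq_zero_or_pos (P.inertiaDeg ℤ) with h0 | h0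
    · rw [h0, pow_zero] at h1
      exact absurd (Ideal.absNorm_eq_one_iff.1 h1.symm) hP.ne_top
    · exact h0
  refine Nat.le_of_mul_le_mul_left ?_ hpos
  calc P.inertiaDeg ℤ * (s.card * E) = e * s.card ^ 2 := by
        rw [mul_left_comm, ← hfib]; ring
    _ ≤ e * (C.card * ∑ σ ∈ s, (classmates (resMap k Q) Finset.univ σ + 1)) :=
        Nat.mul_le_mul_left _ hcs
    _ ≤ e * (P.inertiaDeg ℤ * ∑ σ ∈ s, (classmates (resMap k Q) Finset.univ σ + 1)) := by
        gcongr
    _ = _ := by ring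

/-- The tame lower bound for the total ramification of pairs of embeddings at `Q`. -/
lemma tame_le_sum_classmates (hL : Fintype.card (k →+* L) = Module.finrank ℚ k)
    {Q : Ideal (𝓞 L)} [hQ : Q.IsPrime] (hQ0 : Q ≠ ⊥) {p : ℕ} (hp : p.Prime)
    (hpQ : (p : 𝓞 L) ∈ Q) :
    (Module.finrank ℚ k - inertiaSum k p) * ord Q (Ideal.span {(p : 𝓞 L)})
      ≤ ∑ σ : k →+* L, relRam Q p (resMap k Q σ)
        * classmates (resMap k Q) Finset.univ σ := by
  classical
  set T := (Algebra.QuasiFinite.finite_primesOver (S := 𝓞 k)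
      (Ideal.span {(p : ℤ)})).toFinset with hT
  set E := ord Q (Ideal.span {(p : 𝓞 L)}) with hE
  have hmap : ∀ σ ∈ (Finset.univ : Finset (k →+* L)), RingHom.ker (resMap k Q σ) ∈ T := by
    intro σ _
    rw [hT, Set.Finite.mem_toFinset, ker_residueMap]
    exact ⟨inferInstance, liesOver_span hp (natCast_mem_comap hpQ _)⟩
  have hTP : ∀ P ∈ T, P.IsPrime ∧ P ≠ ⊥ ∧ (p : 𝓞 k) ∈ P := by
    intro P hP
    rw [hT, Set.Finite.mem_toFinset] at hP
    have hmem : (p : 𝓞 k) ∈ P := by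
      have : (p : ℤ) ∈ P.under ℤ := hP.2.over ▸ Ideal.mem_span_singleton_self _
      simpa [Ideal.mem_under] using this
    refine ⟨hP.1, ?_, hmem⟩
    rintro rfl
    exact hp.ne_zero (by exact_mod_cast (Ideal.mem_bot.1 hmem))
  have h1 : ∑ σ : k →+* L, relRam Q p (resMap k Q σ) = inertiaSum k p * E := by
    rw [← Finset.sum_fiberwise_of_maps_to hmap, inertiaSum, Finset.sum_mul]
    refine Finset.sum_congr rfl fun P hP => ?_
    obtain ⟨hP1, hP0, hpP⟩ := hTP P hP
    exact sum_relRam_fiber hL hQ0 hp hpQ hP0 hpP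
  have h2 : Module.finrank ℚ k * E ≤ ∑ σ : k →+* L, relRam Q p (resMap k Q σ)
        * (classmates (resMap k Q) Finset.univ σ + 1) := by
    rw [← hL, ← Finset.card_univ, Finset.card_eq_sum_card_fiberwise hmap,
      ← Finset.sum_fiberwise_of_maps_to hmap, Finset.sum_mul]
    refine Finset.sum_le_sum fun P hP => ?_
    obtain ⟨hP1, hP0, hpP⟩ := hTP P hP
    exact sum_relRam_mul_card_fiber hL hQ0 hp hpQ hP0 hpP
  -- Removing the `+ 1` subtracts the total ramification `f_p E` from `d E`.
  simp only [mul_add, mul_one, Finset.sum_add_distrib, h1] at h2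
  rw [Nat.sub_mul]
  omega

/-! ### Squared minors under ring maps and reindexing. -/

section DetSq

variable {α α' β R R' : Type*} [CommRing R] [CommRing R']

lemma map_detSq (φ : R →+* R') (A : α → β → R) (S : Finset α) (X : Finset β)
    (h : S.card = X.card) : φ (detSq A S X h) = detSq (fun s x => φ (A s x)) S X h := by
  classical
  unfold detSq
  rw [map_pow, RingHom.map_det]
  rfl

lemma detSq_map (ε : α ≃ α') (A : α' → β → R) (S : Finset α) (X : Finset β)
    (h : S.card = X.card) (h' : (S.map ε.toEmbedding).card = X.card) :
    detSq A (S.map ε.toEmbedding) X h' = detSq (fun s x => A (ε s) x) S X h := by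
  classical
  let a : S ≃ S.map ε.toEmbedding := ε.subtypeEquiv fun s => by simp
  exact detSq_eq A _ X h' a (Finset.equivOfCardEq h)

lemma prod_detSq_comp_equiv [Fintype α] [Fintype α'] (ε : α ≃ α') (A : α' → β → R)
    (X : Finset β) (m : ℕ) (hX : X.card = m) :
    ∏ S : {S : Finset α // S.card = m}, detSq (fun s x => A (ε s) x) S.1 X (S.2.trans hX.symm)
      = ∏ S : {S : Finset α' // S.card = m}, detSq A S.1 X (S.2.trans hX.symm) := by
  refine Fintype.prod_equiv (ε.finsetCongr.subtypeEquiv fun S => by simp) _ _ fun S => ?_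
  exact (detSq_map ε A S.1 X _ _).symm

end DetSq

lemma classmates_subtype {ι γ : Type*} (c : ι → γ) (S : Finset ι) (i : S) :
    classmates (fun j : S => c j) Finset.univ i = classmates c S i := by
  classical
  unfold classmates
  refine Finset.card_bij (fun j _ => (j : ι)) ?_ (fun _ _ _ _ h => Subtype.ext h) ?_
  · intro j hj
    simp only [Finset.mem_filter, Finset.mem_univ, true_and] at hj ⊢
    exact ⟨j.2, fun h => hj.1 (Subtype.ext h), hj.2⟩
  · intro j hj
    simp only [Finset.mem_filter] at hj
    refine ⟨⟨j, hj.1⟩, ?_, rfl⟩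
    simp only [Finset.mem_filter, Finset.mem_univ, true_and]
    exact ⟨fun h => hj.2.1 (congrArg Subtype.val h), hj.2.2⟩

/-! ### Divisibility in the ring of integers of `L`. -/

lemma exists_prime_natCast_mem (Q : Ideal (𝓞 L)) [hQ : Q.IsPrime] (hQ0 : Q ≠ ⊥) :
    ∃ p : ℕ, p.Prime ∧ (p : 𝓞 L) ∈ Q := by
  have : Finite (𝓞 L ⧸ Q) := Ideal.finiteQuotientOfFreeOfNeBot Q hQ0
  obtain ⟨p, hp⟩ := CharP.exists (𝓞 L ⧸ Q)
  refine ⟨p, CharP.char_is_prime (𝓞 L ⧸ Q) p, ?_⟩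
  rw [← Ideal.Quotient.eq_zero_iff_mem, map_natCast]
  exact CharP.cast_eq_zero _ p

lemma tameDiscr_ne_zero (k : Type*) [Field k] [NumberField k] : tameDiscr k ≠ 0 := by
  rw [tameDiscr, finprod_eq_prod _ (finite_mulSupport k)]
  exact Finset.prod_ne_zero_iff.2 fun p _ => pow_ne_zero _ p.2.ne_zero

lemma ord_tameDiscr (k : Type*) [Field k] [NumberField k] {Q : Ideal (𝓞 L)} [hQ : Q.IsPrime]
    (hQ0 : Q ≠ ⊥) {p : ℕ} (hp : p.Prime) (hpQ : (p : 𝓞 L) ∈ Q) :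
    ord Q (Ideal.span {(tameDiscr k : 𝓞 L)})
      = (Module.finrank ℚ k - inertiaSum k p) * ord Q (Ideal.span {(p : 𝓞 L)}) := by
  classical
  let p' : Nat.Primes := ⟨p, hp⟩
  -- Inserting `p` keeps its term in the product even when its factor is 1.
  rw [tameDiscr, finprod_eq_prod_of_mulSupport_subset (s := insert p' (finite_mulSupport k).toFinset)
    _ (by intro q hq; simp only [Finset.coe_insert, Set.Finite.coe_toFinset];
          exact Set.mem_insert_of_mem _ hq), Nat.cast_prod, ← Ideal.prod_span_singleton,
    ord_prod _ _ _ fun q _ => span_natCast_ne_bot (pow_ne_zero _ q.2.ne_zero)]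
  simp only [ord_span_natCast_pow]
  refine Finset.sum_eq_single p' (fun q _ hq => ?_) (fun h => absurd (Finset.mem_insert_self _ _) h)
  rw [ord_eq_zero hQ0 (span_natCast_ne_bot q.2.ne_zero), mul_zero]
  rw [Ideal.span_singleton_le_iff_mem]
  intro hqQ
  have hcop : IsCoprime (((q : ℕ) : ℤ)) (p : ℤ) :=
    Nat.isCoprime_iff_coprime.2 ((Nat.coprime_primes q.2 hp).2 fun h => hq (Subtype.ext h))
  obtain ⟨u, v, huv⟩ := hcop
  refine hQ.ne_top ((Ideal.eq_top_iff_one _).2 ?_)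
  have h1 : ((u * q + v * p : ℤ) : 𝓞 L) = 1 := by rw [huv, Int.cast_one]
  rw [← h1]
  push_cast
  exact Q.add_mem (Q.mul_mem_left _ hqQ) (Q.mul_mem_left _ hpQ)

/-- The divisor in the main theorem. -/
def divisor (𝔫 : Ideal (𝓞 k)) (m : ℕ) : ℕ :=
  tameDiscr k ^ (Module.finrank ℚ k - 2).choose (m - 2) *
    𝔫.toAddSubgroup.index ^ (2 * (Module.finrank ℚ k - 1).choose (m - 1))

lemma index_eq_absNorm (𝔫 : Ideal (𝓞 k)) : 𝔫.toAddSubgroup.index = Ideal.absNorm 𝔫 := by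
  rw [Ideal.absNorm_apply, Submodule.cardQuot_apply]
  rfl

lemma divisor_ne_zero {𝔫 : Ideal (𝓞 k)} (h𝔫 : 𝔫 ≠ ⊥) (m : ℕ) : divisor 𝔫 m ≠ 0 := by
  rw [divisor, index_eq_absNorm]
  exact mul_ne_zero (pow_ne_zero _ (tameDiscr_ne_zero k))
    (pow_ne_zero _ (by rwa [Ne, Ideal.absNorm_eq_zero_iff]))

lemma ord_divisor {Q : Ideal (𝓞 L)} [Q.IsPrime] (hQ0 : Q ≠ ⊥) {p : ℕ} (hp : p.Prime)
    (hpQ : (p : 𝓞 L) ∈ Q) {𝔫 : Ideal (𝓞 k)} (h𝔫 : 𝔫 ≠ ⊥) (m : ℕ) :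
    ord Q (Ideal.span {(divisor 𝔫 m : 𝓞 L)}) = (Module.finrank ℚ k - 2).choose (m - 2) *
        ((Module.finrank ℚ k - inertiaSum k p) * ord Q (Ideal.span {(p : 𝓞 L)}))
      + 2 * (Module.finrank ℚ k - 1).choose (m - 1)
        * ord Q (Ideal.span {(Ideal.absNorm 𝔫 : 𝓞 L)}) := by
  rw [divisor, index_eq_absNorm, Nat.cast_mul, ← Ideal.span_singleton_mul_span_singleton, ord_mul,
    ord_span_natCast_pow, ord_span_natCast_pow, ord_tameDiscr k hQ0 hp hpQ]
  · exact span_natCast_ne_bot (pow_ne_zero _ (tameDiscr_ne_zero k))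
  · exact span_natCast_ne_bot (pow_ne_zero _ (by rwa [Ne, Ideal.absNorm_eq_zero_iff]))

theorem prod_detSq_mem_span (hL : Fintype.card (k →+* L) = Module.finrank ℚ k)
    {𝔫 : Ideal (𝓞 k)} (h𝔫 : 𝔫 ≠ ⊥) {m : ℕ} (hm : 2 ≤ m) (X : Finset (𝓞 k))
    (hX : ∀ x ∈ X, x ∈ 𝔫) (hXm : X.card = m) :
    ∏ S : {S : Finset (k →+* L) // S.card = m},
      detSq (fun (σ : k →+* L) (x : 𝓞 k) => RingOfIntegers.mapRingHom σ x) S.1 X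
        (S.2.trans hXm.symm) ∈ Ideal.span {(divisor 𝔫 m : 𝓞 L)} := by
  classical
  rw [← Ideal.span_singleton_le_iff_mem]
  refine le_of_forall_le_pow_ord (span_natCast_ne_bot (divisor_ne_zero h𝔫 m)) fun Q hQ hQ0 => ?_
  rw [Ideal.span_singleton_le_iff_mem]
  obtain ⟨p, hp, hpQ⟩ := exists_prime_natCast_mem Q hQ0
  let e : (k →+* L) → ℕ := fun σ => relRam Q p (resMap k Q σ)
  let n : (k →+* L) → ℕ := fun σ => ord (RingHom.ker (resMap k Q σ)) 𝔫
  let W : Finset (k →+* L) → ℕ := fun S =>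
    ∑ σ ∈ S, (2 * (e σ * n σ) + e σ * classmates (resMap k Q) S σ)
  have hS : ∀ S : {S : Finset (k →+* L) // S.card = m},
      detSq (fun (σ : k →+* L) (x : 𝓞 k) => RingOfIntegers.mapRingHom σ x) S.1 X
        (S.2.trans hXm.symm) ∈ Q ^ W S.1 := by
    intro S
    have h1 := sq_det_mem_pow_ord Q hQ0 hp.ne_zero hpQ
      (fun σ : S.1 => RingOfIntegers.mapRingHom (σ : k →+* L))
      (fun σ => mapRingHom_injective _) 𝔫
      (fun j => (Finset.equivOfCardEq (S.2.trans hXm.symm) j : 𝓞 k))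
      (fun j => hX _ (Finset.coe_mem _))
    have h2 : W S.1 = ∑ i : S.1, (2 * (e i * n i)
        + e i * classmates (fun j : S.1 => resMap k Q j) Finset.univ i) := by
      simp only [classmates_subtype (resMap k Q) S.1]
      exact (Finset.sum_coe_sort S.1 fun σ =>
        2 * (e σ * n σ) + e σ * classmates (resMap k Q) S.1 σ).symm
    rw [h2]
    unfold detSq
    convert h1
  have hprod := Ideal.prod_mem_prod fun S (_ : S ∈ Finset.univ) => hS S
  rw [Finset.prod_pow_eq_pow_sum] at hprod
  refine Ideal.pow_le_pow_right ?_ hprod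
  have hsum : ∑ S : {S : Finset (k →+* L) // S.card = m}, W S.1
      = ∑ S ∈ (Finset.univ : Finset (k →+* L)).powersetCard m, W S :=
    (Finset.sum_subtype _ (fun S => by simp) W).symm
  rw [hsum]
  -- The `𝔫`-part matches the divisor exactly; only the classmates part needs an inequality.
  simp only [W, Finset.sum_add_distrib]
  rw [sum_powersetCard_sum m (by omega), sum_powersetCard_classmates m hm, hL,
    ord_divisor hQ0 hp hpQ h𝔫, ← Finset.mul_sum, sum_relRam_mul_ord hL hQ0 hp hpQ h𝔫, add_comm]
  refine Nat.add_le_add (le_of_eq (by ring)) (Nat.mul_le_mul_left _ ?_)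
  exact tame_le_sum_classmates hL hQ0 hp hpQ

/-! ### Descent to the rational integers. -/

/-- The product of all `m × m` squared minors of the conjugates is a rational integer. -/
lemma exists_int_eq_prod_detSq (X : Finset (𝓞 k)) (m : ℕ) (hXm : X.card = m) :
    ∃ P : ℤ, (P : AlgebraicClosure ℚ) =
      ∏ S : {S : Finset (k →+* AlgebraicClosure ℚ) // S.card = m},
        detSq (fun (σ : k →+* AlgebraicClosure ℚ) (x : 𝓞 k) => σ (x : k)) S.1 X
          (S.2.trans hXm.symm) := by
  set P := ∏ S : {S : Finset (k →+* AlgebraicClosure ℚ) // S.card = m},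
        detSq (fun (σ : k →+* AlgebraicClosure ℚ) (x : 𝓞 k) => σ (x : k)) S.1 X
          (S.2.trans hXm.symm) with hP
  have hint : IsIntegral ℤ P := by
    classical
    refine IsIntegral.prod _ fun S _ => ?_
    unfold detSq
    refine IsIntegral.pow (IsIntegral.det fun i j => ?_) 2
    exact map_isIntegral_int (i : k →+* AlgebraicClosure ℚ) (RingOfIntegers.isIntegral_coe _)
  have hfix : ∀ g : Gal(AlgebraicClosure ℚ/ℚ), g P = P := by
    intro g
    -- Composition with `g` permutes the embeddings, hence the factors of the product.
    let ε : (k →+* AlgebraicClosure ℚ) ≃ (k →+* AlgebraicClosure ℚ) :=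
      { toFun := fun σ => (g : AlgebraicClosure ℚ →+* AlgebraicClosure ℚ).comp σ
        invFun := fun σ => (g.symm : AlgebraicClosure ℚ →+* AlgebraicClosure ℚ).comp σ
        left_inv := fun σ => RingHom.ext fun x => g.symm_apply_apply _
        right_inv := fun σ => RingHom.ext fun x => g.apply_symm_apply _ }
    have h1 := prod_detSq_comp_equiv ε
      (fun (σ : k →+* AlgebraicClosure ℚ) (x : 𝓞 k) => σ (x : k)) X m hXm
    rw [← hP] at h1
    conv_rhs => rw [← h1]
    rw [hP, map_prod]
    exact Finset.prod_congr rfl fun S _ =>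
      map_detSq (g : AlgebraicClosure ℚ →+* AlgebraicClosure ℚ) _ _ _ _
  have : IsAlgClosure ℚ (AlgebraicClosure ℚ) := ⟨inferInstance, AlgebraicClosure.isAlgebraic ℚ⟩
  have : IsGalois ℚ (AlgebraicClosure ℚ) := IsAlgClosure.isGalois ℚ (AlgebraicClosure ℚ)
  obtain ⟨r, hr⟩ := IntermediateField.mem_bot.1 ((InfiniteGalois.mem_bot_iff_fixed P).2 hfix)
  have hr' : IsIntegral ℤ r := by
    rw [← hr] at hint
    exact (isIntegral_algebraMap_iff (algebraMap ℚ (AlgebraicClosure ℚ)).injective).1 hint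
  obtain ⟨z, hz⟩ := IsIntegrallyClosed.isIntegral_iff.1 hr'
  refine ⟨z, ?_⟩
  rw [← hr, ← hz]
  simp

/-- By faithful flatness of `𝓞 L` over `ℤ`, extending `(D)` to `𝓞 L` and contracting back gives
`(D)`. -/
lemma intCast_dvd_of_mem_span {D : ℕ} {z : ℤ} (h : (z : 𝓞 L) ∈ Ideal.span {(D : 𝓞 L)}) :
    (D : ℤ) ∣ z := by
  have h1 := Ideal.comap_map_eq_self_of_faithfullyFlat (B := 𝓞 L) (Ideal.span {(D : ℤ)})
  rw [← Ideal.mem_span_singleton, ← h1, Ideal.mem_comap, Ideal.map_span, Set.image_singleton]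
  simpa using h

/-- The minors in `L` and in an extension `Ω` give the same product, if `k` has the same
embeddings into both. -/
lemma map_prod_detSq {Ω : Type*} [Field Ω] (φ : L →+* Ω)
    (ε : (k →+* L) ≃ (k →+* Ω)) (hε : ∀ σ x, ε σ x = φ (σ x)) (X : Finset (𝓞 k)) (m : ℕ)
    (hXm : X.card = m) [Fintype (k →+* Ω)] :
    φ.comp (algebraMap (𝓞 L) L) (∏ S : {S : Finset (k →+* L) // S.card = m},
      detSq (fun (σ : k →+* L) (x : 𝓞 k) => RingOfIntegers.mapRingHom σ x) S.1 X
        (S.2.trans hXm.symm))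
      = ∏ S : {S : Finset (k →+* Ω) // S.card = m},
        detSq (fun (σ : k →+* Ω) (x : 𝓞 k) => σ (x : k)) S.1 X (S.2.trans hXm.symm) := by
  rw [map_prod, ← prod_detSq_comp_equiv ε _ X m hXm]
  refine Finset.prod_congr rfl fun S _ => ?_
  rw [map_detSq]
  congr 1
  funext σ x
  rw [hε, RingHom.comp_apply]
  rfl

end TameDiv

end

theorem mainTheorem8 (k : Type*) [Field k] [NumberField k] (𝔫 : Ideal (𝓞 k)) (h𝔫 : 𝔫 ≠ ⊥)
    (m : ℕ) (hm : 2 ≤ m) (hmd : m ≤ Module.finrank ℚ k)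
    (X : Finset (𝓞 k)) (hX : ∀ x ∈ X, x ∈ 𝔫) (hXm : X.card = m) :
    ∃ P : ℤ,
      (P : AlgebraicClosure ℚ) =
        ∏ S : {S : Finset (k →+* AlgebraicClosure ℚ) // S.card = m},
          TameDiv.detSq (fun (σ : k →+* AlgebraicClosure ℚ) (x : 𝓞 k) => σ (x : k))
            S.1 X (S.2.trans hXm.symm) ∧
      ((TameDiv.tameDiscr k ^ (Module.finrank ℚ k - 2).choose (m - 2) *
        𝔫.toAddSubgroup.index ^ (2 * (Module.finrank ℚ k - 1).choose (m - 1)) : ℕ) : ℤ) ∣ P := by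
  obtain ⟨P, hP⟩ := TameDiv.exists_int_eq_prod_detSq X m hXm
  refine ⟨P, hP, ?_⟩
  -- The normal closure is a number field receiving all embeddings of `k`, as the local argument
  -- requires.
  let L := IntermediateField.normalClosure ℚ k (AlgebraicClosure ℚ)
  have : NumberField L := ⟨⟩
  let ε : (k →+* L) ≃ (k →+* AlgebraicClosure ℚ) :=
    ((RingHom.equivRatAlgHom k L).trans (normalClosure.algHomEquiv ℚ k (AlgebraicClosure ℚ))).trans
      (RingHom.equivRatAlgHom k (AlgebraicClosure ℚ)).symm
  have hL : Fintype.card (k →+* L) = Module.finrank ℚ k :=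
    (Fintype.card_congr ε).trans (NumberField.Embeddings.card k (AlgebraicClosure ℚ))
  have hmem := TameDiv.prod_detSq_mem_span hL h𝔫 hm X hX hXm
  refine TameDiv.intCast_dvd_of_mem_span (L := L) ?_
  let φ : L →+* AlgebraicClosure ℚ := algebraMap L (AlgebraicClosure ℚ)
  have hφ : Function.Injective (φ.comp (algebraMap (𝓞 L) L)) :=
    φ.injective.comp NumberField.RingOfIntegers.coe_injective
  have hPL := TameDiv.map_prod_detSq φ ε (fun _ _ => rfl) X m hXm
  rw [← hP, ← map_intCast (φ.comp (algebraMap (𝓞 L) L)) P] at hPL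
  rw [← hφ hPL]
  exact hmem
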